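/- Let $p\in\mathbb N$ and $[p]=\{1,\dots,p\}$. A map $T:\mathbb R^p\to\mathbb R^p$ is \emph{triangular monotone increasing} (TMI) if, for each $k$, its component $T_k$ depends only on $(u_1,\dots,u_k)$ and is strictly increasing in $u_k$ for every fixed $(u_1,\dots,u_{k-1})$. Let $\mathcal F$ be the set of Borel measurable TMI maps and $\mathcal P_{\mathbf U}$ the set of product probability measures $\bigotimes_{j=1}^p P_{U_j}$ on $\mathbb R^p$. Structural causal models and causal normalizing flows (CNFs) are represented by pairs $(\mathbf F,P_{\mathbf U})\in\mathcal F\times\mathcal P_{\mathbf U}$: the features are $\mathbf X=\mathbf F(\mathbf U)$ with exogenous noise $\mathbf U\sim P_{\mathbf U}$. Let $\mathcal N:\mathbb R^p\to\mathbb R$ be measurable (the neural network), $\hat Y=\mathcal N(\mathbf X)$, and let $\mathcal G$ be a directed acyclic graph on $[p]$ (the causal graph). The observational distribution of a pair is the joint law $P(\mathbf X,\hat Y)$. For $I\subseteq[p]$ put $\phi(\hat Y\mid\mathbf U_I)=\mathbb V(\mathbb E(\hat Y\mid\mathbf U_I))$ or, when $\mathbb V(\hat Y)\neq0$, its normalized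 version $\mathbb V(\mathbb E(\hat Y\mid\mathbf U_I))/\mathbb V(\hat Y)$. For $j\in[p]$ and $I\subseteq[p]\setminus\{j\}$ define the intrinsic causal contributions $$ICC_\phi(X_j\to\hat Y\mid I)=\phi(\hat Y\mid\mathbf U_{I\cup\{j\}})-\phi(\hat Y\mid\mathbf U_I),$$ $$ICC^{\mathrm{Sh}}_\phi(X_j\to\hat Y)=\sum_{T\subseteq[p]\setminus\{j\}}\frac{1}{p\binom{p-1}{|T|}}\,ICC_\phi(X_j\to\hat Y\mid T),$$ $$ICC^{\mathrm{To}}_\phi(X_j\to\hat Y)=\frac1{|\mathcal C(\mathcal G)|}\sum_{\pi\in\mathcal C(\mathcal G)}ICC_\phi\bigl(X_j\to\hat Y\mid\{k:\pi(k)<\pi(j)\}\bigr),$$ where $\mathcal C(\mathcal G)$ is the set of permutations $\pi$ of $[p]$ with $\pi(i)<\pi(j)$ for every edge $i\to j$ of $\mathcal G$. \textbf{Theorem.} Let $(\mathbf F,P_{\mathbf U})\in\mathcal F\times\mathcal P_{\mathbf U}$ be the data-generating model, where $\mathbf F$ is a bijection of $\mathbb R^p$ such that $\mathbf F$ and $\mathbf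 F^{-1}$ are differentiable, and suppose $\mathbb E(\hat Y^2)<\infty$. Let $(\mathbf F_{\theta_1},P_{\theta_1}),(\mathbf F_{\theta_2},P_{\theta_2})\in\mathcal F\times\mathcal P_{\mathbf U}$ be two CNFs which both have the same observational distribution $P(\mathbf X,\hat Y)$ as $(\mathbf F,P_{\mathbf U})$. Then, for every feature $j$, $$ICC_{\phi,\theta_1}(X_j\to\hat Y)=ICC_{\phi,\theta_2}(X_j\to\hat Y),$$ and both equal the contribution computed from $(\mathbf F,P_{\mathbf U})$. This holds for $ICC_\phi(\,\cdot\mid I)$ with every context $I\subseteq[p]\setminus\{j\}$, for $ICC^{\mathrm{Sh}}_\phi$ and for $ICC^{\mathrm{To}}_\phi$, with the unnormalized $\phi$ and, if $\mathbb V(\hat Y)\ne0$, also with the normalized $\phi$. Consequently all these contributions are identifiable: for fixed $\mathcal N$ and $\mathcal G$, each of them is, on the class of data-generating models as above (with $\mathbb V(\hat Y)\neq0$ for the normalized $\phi$), a function of the observational distribution $P(\mathbf X,\hat Y)$ alone. -/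

import Mathlib

open MeasureTheory ProbabilityTheory

/-! ## Triangular monotone maps and structural causal models -/

/-- `T : ℝᵖ → ℝᵖ` is triangular monotone increasing: the `k`-th component depends only on the
first `k` inputs and is strictly increasing in the `k`-th input, the others being fixed. -/
structure IsTMI {p : ℕ} (T : (Fin p → ℝ) → (Fin p → ℝ)) : Prop where
  triangular : ∀ (k : Fin p) (u v : Fin p → ℝ), (∀ i, i ≤ k → u i = v i) → T u k = T v k
  strictMono : ∀ (k : Fin p) (u : Fin p → ℝ), StrictMono fun t : ℝ => T (Function.update u k t) k

/-- A law on `ℝᵖ` that is a product of `p` probability measures on `ℝ`. -/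
def IsFullyFactorized {p : ℕ} (P : Measure (Fin p → ℝ)) : Prop :=
  ∃ μ : Fin p → Measure ℝ, (∀ i, IsProbabilityMeasure (μ i)) ∧ P = Measure.pi μ

/-- `F` is invertible, and both `F` and its inverse are differentiable. -/
def IsDiffeomorphic {p : ℕ} (F : (Fin p → ℝ) → (Fin p → ℝ)) : Prop :=
  ∃ G : (Fin p → ℝ) → (Fin p → ℝ), Function.LeftInverse G F ∧ Function.RightInverse G F ∧
    Differentiable ℝ F ∧ Differentiable ℝ G

/-- A pair `(F, P_U)`: the features are `X = F U` with exogenous noise `U ∼ P_U`. -/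
structure CausalModel (p : ℕ) where
  /-- the map from the exogenous noise to the features -/
  F : (Fin p → ℝ) → (Fin p → ℝ)
  /-- the law of the exogenous noise -/
  PU : Measure (Fin p → ℝ)

namespace CausalModel

variable {p : ℕ}

/-- The family of pairs of a (Borel measurable) TMI map and a fully factorized noise law. Both
the causal normalizing flows and the structural causal models are members of this family. -/
structure InFamily (M : CausalModel p) : Prop where
  measurable : Measurable M.F
  tmi : IsTMI M.F
  factorized : IsFullyFactorized M.PU

/-- Diffeomorphic data-generating process and causal sufficiency. -/
structure DiffeoSufficient (M : CausalModel p) : Prop where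
  diffeomorphic : IsDiffeomorphic M.F
  sufficient : IsFullyFactorized M.PU

/-- The output `Ŷ = N (F U)` as a random variable on the noise space `(ℝᵖ, P_U)`. -/
def output (M : CausalModel p) (N : (Fin p → ℝ) → ℝ) : (Fin p → ℝ) → ℝ := fun u => N (M.F u)

/-- The observational distribution `P(X, Ŷ)`: the joint law of features and output. -/
noncomputable def observational (M : CausalModel p) (N : (Fin p → ℝ) → ℝ) :
    Measure ((Fin p → ℝ) × ℝ) :=
  M.PU.map fun u => (M.F u, M.output N u)

/-- The sigma-algebra on the noise space generated by the noise variables `U_i`, `i ∈ I`. -/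
@[reducible] def noiseSigma (I : Finset (Fin p)) : MeasurableSpace (Fin p → ℝ) :=
  MeasurableSpace.comap (fun (u : Fin p → ℝ) (i : I) => u i) inferInstance

/-- `φ(Ŷ | U_I) = 𝕍(𝔼(Ŷ | U_I))`. -/
noncomputable def phi (M : CausalModel p) (N : (Fin p → ℝ) → ℝ) (I : Finset (Fin p)) : ℝ :=
  variance (condExp (noiseSigma I) M.PU (M.output N)) M.PU

/-- The normalized version `φ(Ŷ | U_I) = 𝕍(𝔼(Ŷ | U_I)) / 𝕍(Ŷ)`. -/
noncomputable def normPhi (M : CausalModel p) (N : (Fin p → ℝ) → ℝ) (I : Finset (Fin p)) : ℝ :=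
  M.phi N I / variance (M.output N) M.PU

end CausalModel

/-! ## Intrinsic causal contributions

Here `φ I` stands for `φ(Ŷ | U_I)`. -/

/-- The intrinsic causal contribution of feature `j` given the context `I`. -/
def icc {p : ℕ} (φ : Finset (Fin p) → ℝ) (j : Fin p) (I : Finset (Fin p)) : ℝ :=
  φ (insert j I) - φ I

/-- The Shapley-based intrinsic causal contribution. -/
noncomputable def iccShapley {p : ℕ} (φ : Finset (Fin p) → ℝ) (j : Fin p) : ℝ :=
  ∑ T ∈ (Finset.univ.erase j).powerset,
    1 / ((p : ℝ) * ((p - 1).choose T.card : ℝ)) * icc φ j T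

/-- A directed graph without directed cycles. -/
def IsDAG {p : ℕ} (G : Digraph (Fin p)) : Prop := ∀ i, ¬ Relation.TransGen G.Adj i i

open Classical in
/-- The causal orderings of `G`: permutations `π`, where `π i` is the position of `i`, such that
every edge goes from an earlier to a later position. -/
noncomputable def causalOrderings {p : ℕ} (G : Digraph (Fin p)) : Finset (Equiv.Perm (Fin p)) :=
  Finset.univ.filter fun π => ∀ i j, G.Adj i j → π i < π j

/-- The set of indices that occur before `j` in the ordering `π`. -/
def predecessors {p : ℕ} (π : Equiv.Perm (Fin p)) (j : Fin p) : Finset (Fin p) :=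
  Finset.univ.filter fun k => π k < π j

/-- The intrinsic causal contribution averaged over all causal orderings of `G`. -/
noncomputable def iccTopological {p : ℕ} (G : Digraph (Fin p)) (φ : Finset (Fin p) → ℝ)
    (j : Fin p) : ℝ :=
  1 / ((causalOrderings G).card : ℝ) * ∑ π ∈ causalOrderings G, icc φ j (predecessors π j)

/-- Two uncertainty functions give every feature the same contribution: in every context, and
for both the Shapley-based and the topological version. -/
def SameICC {p : ℕ} (G : Digraph (Fin p)) (φ φ' : Finset (Fin p) → ℝ) : Prop :=
  ∀ j : Fin p, (∀ I : Finset (Fin p), j ∉ I → icc φ j I = icc φ' j I) ∧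
    iccShapley φ j = iccShapley φ' j ∧ iccTopological G φ j = iccTopological G φ' j

/-- A quantity `Q` attached to causal models is identifiable within the class `C`: its value is
computed from the observational distribution alone. -/
def IsIdentifiable {p : ℕ} (N : (Fin p → ℝ) → ℝ) (C : Set (CausalModel p))
    (Q : CausalModel p → ℝ) : Prop :=
  ∃ Ψ : Measure ((Fin p → ℝ) × ℝ) → ℝ, ∀ M ∈ C, Q M = Ψ (M.observational N)

/-- Every contribution of every feature is identifiable within `C`. -/
def ICCIdentifiable {p : ℕ} (N : (Fin p → ℝ) → ℝ) (G : Digraph (Fin p)) (C : Set (CausalModel p))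
    (φ : CausalModel p → Finset (Fin p) → ℝ) : Prop :=
  ∀ j : Fin p,
    (∀ I : Finset (Fin p), j ∉ I → IsIdentifiable N C fun M => icc (φ M) j I) ∧
    (IsIdentifiable N C fun M => iccShapley (φ M) j) ∧
    (IsIdentifiable N C fun M => iccTopological G (φ M) j)

/-! ## Triangular monotone maps -/

/-! Let `M` be the data-generating model with map `F`, and `M'` an observationally equivalent model
with map `F'`. The features have the same law, so `T = F⁻¹ ∘ F'` carries the noise law of `M'` to
that of `M`, and `T` is again triangular monotone (`IsTMI.of_comp_left`).

The crux is that such a `T` between product laws acts coordinatewise almost everywhere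
(`IsTMI.exists_ae_apply_eq`). The inputs below `k` can be recovered from the outputs below `k`, so
they are independent of the `k`-th output. Hence for almost every value of the earlier inputs, the
`k`-th component pushes the `k`-th noise law to the same target. Monotone transport is unique almost
everywhere, so this component cannot depend on the earlier inputs.

Thus the outputs agree after a strictly increasing change of each noise variable. This preserves the
information in every `U_I`, hence `φ`, through which all contributions are computed. -/

/-- A triangular monotone bijection reflects agreement on initial segments. -/
theorem IsTMI.eq_of_apply_eq {p : ℕ} {F : (Fin p → ℝ) → (Fin p → ℝ)} (hF : IsTMI F)
    {u v : Fin p → ℝ} (k : Fin p) (h : ∀ i, i ≤ k → F u i = F v i) : ∀ i, i ≤ k → u i = v i := by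
  intro i
  induction i using WellFoundedLT.induction with
  | ind i ih =>
    intro hik
    -- By induction `u` and `v` agree below `i`, so overwriting coordinate `i` reduces the
    -- comparison to one variable.
    have hv : F (Function.update u i (v i)) i = F v i := by
      refine hF.triangular i _ _ fun m hm => ?_
      rcases hm.eq_or_lt with rfl | hlt
      · simp
      · rw [Function.update_of_ne hlt.ne]
        exact ih m hlt (hlt.le.trans hik)
    refine (hF.strictMono i u).injective ?_
    simp only [hv, Function.update_eq_self]
    exact h i hik

/-- If `F` and `F ∘ T` are triangular monotone increasing, then so is `T`. -/
theorem IsTMI.of_comp_left {p : ℕ} {F T : (Fin p → ℝ) → (Fin p → ℝ)} (hF : IsTMI F)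
    (hFT : IsTMI (F ∘ T)) : IsTMI T := by
  have tri : ∀ (k : Fin p) (u v : Fin p → ℝ), (∀ i, i ≤ k → u i = v i) →
      ∀ i, i ≤ k → T u i = T v i := fun k u v h =>
    hF.eq_of_apply_eq k fun i hi => hFT.triangular i u v fun m hm => h m (hm.trans hi)
  refine ⟨fun k u v h => tri k u v h k le_rfl, fun k w s t hst => ?_⟩
  have hlt := hFT.strictMono k w hst
  set u := T (Function.update w k s)
  set v := T (Function.update w k t)
  have hbelow : ∀ i, i < k → u i = v i := fun i hi => by
    refine tri i _ _ (fun m hm => ?_) i le_rfl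
    have hmk : m ≠ k := (hm.trans_lt hi).ne
    rw [Function.update_of_ne hmk, Function.update_of_ne hmk]
  have hv' : F (Function.update u k (v k)) k = F v k := by
    refine hF.triangular k _ _ fun m hm => ?_
    rcases hm.eq_or_lt with rfl | h
    · simp
    · rw [Function.update_of_ne h.ne]
      exact hbelow m h
  refine (hF.strictMono k u).lt_iff_lt.1 ?_
  change F (Function.update u k (u k)) k < F (Function.update u k (v k)) k
  rw [hv', Function.update_eq_self]
  exact hlt

/-! ## Monotone transport -/

/-- Two monotone functions whose sublevel sets have the same finite measure agree almost everywhere. -/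
theorem ae_eq_of_monotone_of_measure_lt_eq {ν : Measure ℝ} [IsFiniteMeasure ν] {f g : ℝ → ℝ}
    (hf : Monotone f) (hg : Monotone g)
    (h : ∀ q : ℚ, ν {t | f t < q} = ν {t | g t < q}) : f =ᵐ[ν] g := by
  have key : ∀ {f g : ℝ → ℝ}, Monotone f → Monotone g →
      (∀ q : ℚ, ν {t | f t < q} = ν {t | g t < q}) → ∀ᵐ t ∂ν, g t ≤ f t := by
    intro f g hf hg h
    have hq : ∀ q : ℚ, ∀ᵐ t ∂ν, ¬ (f t < q ∧ (q : ℝ) ≤ g t) := by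
      intro q
      have hnull : ν ({t | f t < q} \ {t | g t < q}) = 0 := by
        -- Sublevel sets of monotone functions are lower sets, hence nested; nested sets of equal
        -- finite measure differ by a null set.
        by_cases hsub : {t | f t < q} ⊆ {t | g t < q}
        · rw [Set.sdiff_eq_empty.2 hsub, measure_empty]
        · obtain ⟨x, hx, hx'⟩ := Set.not_subset.1 hsub
          have hsub' : {t | g t < q} ⊆ {t | f t < q} := fun t ht => by
            have htx : t ≤ x := le_of_not_gt fun hlt =>
              hx' ((hg hlt.le).trans_lt ht)
            exact (hf htx).trans_lt hx
          rw [measure_sdiff hsub' (measurableSet_lt hg.measurable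
            measurable_const).nullMeasurableSet (measure_ne_top _ _), h q, tsub_self]
      filter_upwards [measure_eq_zero_iff_ae_notMem.1 hnull] with t ht hc
      exact ht ⟨hc.1, not_lt.2 hc.2⟩
    filter_upwards [ae_all_iff.2 hq] with t ht
    by_contra hlt
    obtain ⟨q, hq₁, hq₂⟩ := exists_rat_btwn (not_le.1 hlt)
    exact ht q ⟨hq₁, hq₂.le⟩
  filter_upwards [key hf hg h, key hg hf fun q => (h q).symm] with t h₁ h₂
  exact le_antisymm h₂ h₁

/-- A family of monotone functions whose values are independent of the parameter is almost
everywhere constant in the parameter. -/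
theorem exists_ae_eq_of_map_eq_prod {W : Type*} [MeasurableSpace W] {ρ : Measure W}
    [IsProbabilityMeasure ρ] {ν μ : Measure ℝ} [IsProbabilityMeasure ν] [IsProbabilityMeasure μ]
    {h : W → ℝ → ℝ} (hm : Measurable (Function.uncurry h)) (hmono : ∀ w, Monotone (h w))
    (hmap : (ρ.prod ν).map (fun z => (z.1, h z.1 z.2)) = ρ.prod μ) :
    ∃ w₀, ∀ᵐ z ∂ρ.prod ν, h z.1 z.2 = h w₀ z.2 := by
  have hm' : Measurable fun z : W × ℝ => h z.1 z.2 := hm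
  have hsec : ∀ q : ℚ, ∀ᵐ w ∂ρ, ν {t | h w t < q} = μ (Set.Iio (q : ℝ)) := by
    intro q
    have hS : MeasurableSet {z : W × ℝ | h z.1 z.2 < q} := measurableSet_lt hm' measurable_const
    -- Over each `B`, both sides integrate to the mass of `B ×ˢ Set.Iio q` under `ρ.prod μ`.
    refine ae_eq_of_forall_setLIntegral_eq_of_sigmaFinite
      (measurable_measure_prodMk_left hS) measurable_const fun B hB _ => ?_
    have h₁ : ρ.prod μ (B ×ˢ Set.Iio (q : ℝ)) =
        ρ.prod ν ((Prod.fst ⁻¹' B) ∩ {z : W × ℝ | h z.1 z.2 < q}) := by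
      rw [← hmap, Measure.map_apply (measurable_fst.prodMk hm') (hB.prod measurableSet_Iio)]
      rfl
    rw [Measure.prod_prod, Measure.prod_apply ((measurable_fst hB).inter hS)] at h₁
    rw [setLIntegral_const, mul_comm, h₁, ← lintegral_indicator hB]
    refine lintegral_congr fun w => ?_
    by_cases hw : w ∈ B
    · rw [Set.indicator_of_mem hw]
      congr 1
      ext t
      simp [hw]
    · rw [Set.indicator_of_notMem hw]
      symm
      convert measure_empty (μ := ν)
      ext t
      simp [hw]
  have hall := ae_all_iff.2 hsec
  -- Restricting to rational `q` leaves countably many conditions, so one parameter satisfies all of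
  -- them.
  obtain ⟨w₀, hw₀⟩ := hall.exists
  have hm₀ : Measurable (h w₀) := (hmono w₀).measurable
  refine ⟨w₀, (Measure.ae_prod_iff_ae_ae
    (measurableSet_eq_fun hm' (hm₀.comp measurable_snd))).2 ?_⟩
  filter_upwards [hall] with w hw
  exact ae_eq_of_monotone_of_measure_lt_eq (hmono w) (hmono w₀) fun q => (hw q).trans (hw₀ q).symm

/-- The values of the coordinates below `k`. -/
def initialSegment {p : ℕ} (k : Fin p) (u : Fin p → ℝ) (i : Finset.Iio k) : ℝ := u i

/-- Extension by zero of values of the coordinates below `k`. -/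
noncomputable def zeroExtend {p : ℕ} (k : Fin p) (w : Finset.Iio k → ℝ) (i : Fin p) : ℝ :=
  if hi : i < k then w ⟨i, Finset.mem_Iio.2 hi⟩ else 0

theorem measurable_initialSegment {p : ℕ} (k : Fin p) : Measurable (initialSegment k) :=
  measurable_pi_lambda _ fun i => measurable_pi_apply i.1

theorem measurable_zeroExtend {p : ℕ} (k : Fin p) : Measurable (zeroExtend k) := by
  refine measurable_pi_lambda _ fun i => ?_
  unfold zeroExtend
  split_ifs with hi
  · exact measurable_pi_apply _
  · exact measurable_const

theorem zeroExtend_of_lt {p : ℕ} {k i : Fin p} (hi : i < k) (w : Finset.Iio k → ℝ) :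
    zeroExtend k w i = w ⟨i, Finset.mem_Iio.2 hi⟩ := dif_pos hi

theorem indepFun_initialSegment_eval {p : ℕ} (μ : Fin p → Measure ℝ)
    [∀ i, IsProbabilityMeasure (μ i)] (k : Fin p) :
    IndepFun (initialSegment k) (fun u => u k) (Measure.pi μ) := by
  have hind : iIndepFun (fun (i : Fin p) (u : Fin p → ℝ) => u i) (Measure.pi μ) :=
    iIndepFun_pi (X := fun _ x => x) fun _ => aemeasurable_id
  have := hind.indepFun_finset (Finset.Iio k) {k} (by simp) fun i => measurable_pi_apply i
  exact this.comp measurable_id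
    (measurable_pi_apply (⟨k, Finset.mem_singleton_self k⟩ : ({k} : Finset (Fin p))))

/-- The coordinates below `k` are a measurable function of the coordinates below `k` of the image
under a triangular monotone map. -/
theorem IsTMI.exists_initialSegment_eq {p : ℕ} {T : (Fin p → ℝ) → (Fin p → ℝ)} (hT : IsTMI T)
    (hTm : Measurable T) (k : Fin p) :
    ∃ g : (Finset.Iio k → ℝ) → (Finset.Iio k → ℝ), Measurable g ∧
      ∀ u, g (initialSegment k (T u)) = initialSegment k u := by
  have hfac : ∀ u, initialSegment k (T (zeroExtend k (initialSegment k u))) =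
      initialSegment k (T u) := fun u => funext fun i => by
    refine hT.triangular i _ _ fun m hm => ?_
    exact zeroExtend_of_lt (hm.trans_lt (Finset.mem_Iio.1 i.2)) _
  have hinj : Function.Injective fun w => initialSegment k (T (zeroExtend k w)) := by
    intro w w' hww
    funext i
    have hi := Finset.mem_Iio.1 i.2
    have := hT.eq_of_apply_eq (u := zeroExtend k w) (v := zeroExtend k w') i.1
      (fun m hm => congrFun hww ⟨m, Finset.mem_Iio.2 (hm.trans_lt hi)⟩) i le_rfl
    rwa [zeroExtend_of_lt hi, zeroExtend_of_lt hi] at this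
  -- Lusin–Souslin: an injective Borel map between standard Borel spaces has a measurable left
  -- inverse.
  have hemb : MeasurableEmbedding fun w => initialSegment k (T (zeroExtend k w)) :=
    Measurable.measurableEmbedding ((measurable_initialSegment k).comp
      (hTm.comp (measurable_zeroExtend k))) hinj
  refine ⟨hemb.invFun, hemb.measurable_invFun, fun u => ?_⟩
  rw [← hfac u]
  exact hemb.leftInverse_invFun _

/-- A triangular monotone map between product measures acts coordinatewise, up to null sets. -/
theorem IsTMI.exists_ae_apply_eq {p : ℕ} {T : (Fin p → ℝ) → (Fin p → ℝ)} (hT : IsTMI T)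
    (hTm : Measurable T) (ν μ : Fin p → Measure ℝ) [∀ i, IsProbabilityMeasure (ν i)]
    [∀ i, IsProbabilityMeasure (μ i)] (hmap : (Measure.pi ν).map T = Measure.pi μ) (k : Fin p) :
    ∃ u₀ : Fin p → ℝ, ∀ᵐ u ∂Measure.pi ν, T u k = T (Function.update u₀ k (u k)) k := by
  -- By triangularity the zeros placed above `k` have no effect.
  set h : (Finset.Iio k → ℝ) → ℝ → ℝ :=
    fun w t => T (Function.update (zeroExtend k w) k t) k
  have hTk : ∀ u, h (initialSegment k u) (u k) = T u k := fun u => by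
    refine hT.triangular k _ _ fun m hm => ?_
    rcases hm.eq_or_lt with rfl | hlt
    · simp
    · rw [Function.update_of_ne hlt.ne]
      exact zeroExtend_of_lt hlt _
  have hm : Measurable (Function.uncurry h) := by
    refine (measurable_pi_apply k).comp (hTm.comp (measurable_pi_lambda _ fun i => ?_))
    by_cases hi : i = k
    · subst hi
      simpa using measurable_snd
    · simp only [Function.update_of_ne hi]
      exact (measurable_pi_apply i).comp ((measurable_zeroExtend k).comp measurable_fst)
  have hseg := measurable_initialSegment k
  have hev : Measurable fun u : Fin p → ℝ => u k := measurable_pi_apply k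
  set ρ := (Measure.pi ν).map (initialSegment k)
  have : IsProbabilityMeasure ρ := Measure.isProbabilityMeasure_map hseg.aemeasurable
  have hlaw : ∀ η : Fin p → Measure ℝ, (∀ i, IsProbabilityMeasure (η i)) →
      (Measure.pi η).map (fun u => u k) = η k := fun η _ => (measurePreserving_eval η k).map_eq
  have hprod : (Measure.pi ν).map (fun u => (initialSegment k u, u k)) = ρ.prod (ν k) := by
    rw [(indepFun_iff_map_prod_eq_prod_map_map hseg.aemeasurable hev.aemeasurable).1
      (indepFun_initialSegment_eval ν k), hlaw ν inferInstance]
  -- The outputs are independent because their law is a product; applying `g` turns the earlier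
  -- outputs into the earlier inputs.
  have hind : IndepFun (initialSegment k) (fun u => T u k) (Measure.pi ν) := by
    obtain ⟨g, hg, hgT⟩ := hT.exists_initialSegment_eq hTm k
    have hV : IndepFun (initialSegment k ∘ T) ((fun u => u k) ∘ T) (Measure.pi ν) := by
      rw [indepFun_iff_map_prod_eq_prod_map_map (hseg.comp hTm).aemeasurable
        (hev.comp hTm).aemeasurable, ← Measure.map_map hseg hTm, ← Measure.map_map hev hTm, hmap,
        ← (indepFun_iff_map_prod_eq_prod_map_map hseg.aemeasurable hev.aemeasurable).1
          (indepFun_initialSegment_eval μ k), ← hmap, Measure.map_map (hseg.prodMk hev) hTm]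
      rfl
    have := hV.comp hg measurable_id
    have hcomp : g ∘ initialSegment k ∘ T = initialSegment k := funext hgT
    rw [hcomp] at this
    exact this
  have hTlaw : (Measure.pi ν).map (fun u => T u k) = μ k := by
    rw [← hlaw μ inferInstance, ← hmap, Measure.map_map hev hTm]
    rfl
  have hm' : Measurable fun z : (Finset.Iio k → ℝ) × ℝ => h z.1 z.2 := hm
  have hjoint : (ρ.prod (ν k)).map (fun z => (z.1, h z.1 z.2)) = ρ.prod (μ k) := by
    rw [← hprod, Measure.map_map (measurable_fst.prodMk hm') (hseg.prodMk hev), ← hTlaw]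
    refine Eq.trans ?_ ((indepFun_iff_map_prod_eq_prod_map_map hseg.aemeasurable
      (hev.comp hTm).aemeasurable).1 hind)
    congr 1
    funext u
    exact Prod.ext rfl (hTk u)
  obtain ⟨w₀, hw₀⟩ := exists_ae_eq_of_map_eq_prod hm
    (fun w => (hT.strictMono k (zeroExtend k w)).monotone) hjoint
  refine ⟨zeroExtend k w₀, ?_⟩
  rw [← hprod] at hw₀
  filter_upwards [ae_of_ae_map (hseg.prodMk hev).aemeasurable hw₀] with u hu
  rw [← hTk u]
  exact hu

/-! ## Conditional expectations under a change of variables -/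

/-- Conditional expectations are compatible with push-forwards. -/
theorem condExp_comp_ae_eq {α β : Type*} {m : MeasurableSpace β} [mα : MeasurableSpace α]
    [mβ : MeasurableSpace β] {P : Measure α} [IsFiniteMeasure P] {S : α → β} (hS : Measurable S)
    (hm : m ≤ mβ) {Y : β → ℝ} (hY : Integrable Y (P.map S)) :
    condExp (m.comap S) P (Y ∘ S) =ᵐ[P] condExp m (P.map S) Y ∘ S := by
  have hm' : m.comap S ≤ mα := (MeasurableSpace.comap_mono hm).trans hS.comap_le
  have hint : Integrable (condExp m (P.map S) Y ∘ S) P :=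
    integrable_condExp.comp_measurable hS
  refine (ae_eq_condExp_of_forall_setIntegral_eq hm' (hY.comp_measurable hS)
    (fun _ _ _ => hint.integrableOn) ?_ ?_).symm
  · rintro _ ⟨A, hA, rfl⟩ _
    have h₁ := setIntegral_map (hm A hA) integrable_condExp.aestronglyMeasurable
      hS.aemeasurable (f := condExp m (P.map S) Y)
    have h₂ := setIntegral_map (hm A hA) hY.aestronglyMeasurable hS.aemeasurable
    have h₃ := setIntegral_condExp hm hY hA
    exact h₁.symm.trans (h₃.trans h₂)
  · have hS' : Measurable[m.comap S, m] S := comap_measurable S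
    exact (stronglyMeasurable_condExp.comp_measurable hS').aestronglyMeasurable

/-! ### Observationally equivalent models and reparametrization of the noise -/

namespace CausalModel

variable {p : ℕ}

theorem noiseSigma_le (I : Finset (Fin p)) : noiseSigma I ≤ MeasurableSpace.pi :=
  Measurable.comap_le (measurable_pi_lambda _ fun i => measurable_pi_apply i.1)

/-- A coordinatewise injective transformation of the noise preserves the information carried by
any subset of the noise variables. -/
theorem comap_noiseSigma {s : Fin p → ℝ → ℝ} (hs : ∀ i, Measurable (s i))
    (hinj : ∀ i, Function.Injective (s i)) (I : Finset (Fin p)) :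
    (noiseSigma I).comap (fun u i => s i (u i)) = noiseSigma I := by
  have hemb : MeasurableEmbedding fun (w : I → ℝ) (i : I) => s i (w i) :=
    Measurable.measurableEmbedding
      (measurable_pi_lambda _ fun i => (hs i).comp (measurable_pi_apply i))
      fun w w' h => funext fun i => hinj i (congrFun h i)
  unfold noiseSigma
  -- An embedding pulls the Borel sigma-algebra back to itself, so both sides become pullbacks along
  -- the same composite.
  conv_rhs => rw [← hemb.comap_eq]
  rw [MeasurableSpace.comap_comp, MeasurableSpace.comap_comp]
  rfl

theorem map_F_eq_of_observational_eq {N : (Fin p → ℝ) → ℝ} (hN : Measurable N)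
    {M M' : CausalModel p} (hM : Measurable M.F) (hM' : Measurable M'.F)
    (h : M'.observational N = M.observational N) : M'.PU.map M'.F = M.PU.map M.F := by
  have := congrArg (Measure.map Prod.fst) h
  have hout : ∀ {K : CausalModel p}, Measurable K.F → Measurable fun u => (K.F u, K.output N u) :=
    fun hK => hK.prodMk (hN.comp hK)
  unfold observational at this
  rwa [Measure.map_map measurable_fst (hout hM'), Measure.map_map measurable_fst (hout hM)] at this

/-- Observationally equivalent models differ by a coordinatewise strictly increasing
reparametrization of the noise, up to null sets. -/
theorem exists_reparametrization {N : (Fin p → ℝ) → ℝ} (hN : Measurable N)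
    {M M' : CausalModel p} (hM : M.InFamily) (hD : M.DiffeoSufficient) (hM' : M'.InFamily)
    (h : M'.observational N = M.observational N) :
    ∃ s : Fin p → ℝ → ℝ, (∀ i, StrictMono (s i)) ∧
      M'.PU.map (fun u i => s i (u i)) = M.PU ∧
      M'.output N =ᵐ[M'.PU] M.output N ∘ fun u i => s i (u i) := by
  obtain ⟨μ, hμ, hP⟩ := hM.factorized
  obtain ⟨ν, hν, hP'⟩ := hM'.factorized
  obtain ⟨G, hGF, hFG, -, hGd⟩ := hD.diffeomorphic
  have hGm : Measurable G := hGd.continuous.measurable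
  have hcomp : M.F ∘ (G ∘ M'.F) = M'.F := funext fun u => hFG (M'.F u)
  have hT : IsTMI (G ∘ M'.F) := hM.tmi.of_comp_left (hcomp.symm ▸ hM'.tmi)
  have hTm : Measurable (G ∘ M'.F) := hGm.comp hM'.measurable
  have hmap : M'.PU.map (G ∘ M'.F) = M.PU := by
    rw [← Measure.map_map hGm hM'.measurable,
      map_F_eq_of_observational_eq hN hM.measurable hM'.measurable h,
      Measure.map_map hGm hM.measurable, hGF.comp_eq_id, Measure.map_id]
  rw [hP, hP'] at hmap
  choose u₀ hu₀ using hT.exists_ae_apply_eq hTm ν μ hmap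
  have hae : (G ∘ M'.F) =ᵐ[M'.PU]
      fun u i => (G ∘ M'.F) (Function.update (u₀ i) i (u i)) i := by
    rw [hP']
    filter_upwards [ae_all_iff.2 hu₀] with u hu
    exact funext hu
  refine ⟨fun i t => (G ∘ M'.F) (Function.update (u₀ i) i t) i,
    fun i => hT.strictMono i (u₀ i), ?_, ?_⟩
  · rw [← Measure.map_congr hae, hP', hP, hmap]
  · filter_upwards [hae] with u hu
    rw [Function.comp_apply, ← hu]
    exact congrArg N (hFG (M'.F u)).symm

theorem InFamily.isProbabilityMeasure {M : CausalModel p} (hM : M.InFamily) :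
    IsProbabilityMeasure M.PU := by
  obtain ⟨μ, hμ, hP⟩ := hM.factorized
  rw [hP]
  infer_instance

/-- Observationally equivalent models give the same variance of the output and the same
variance of its conditional expectations. -/
theorem variance_output_eq_and_phi_eq {N : (Fin p → ℝ) → ℝ} (hN : Measurable N)
    {M M' : CausalModel p} (hM : M.InFamily) (hD : M.DiffeoSufficient)
    (hL : MemLp (M.output N) 2 M.PU) (hM' : M'.InFamily)
    (h : M'.observational N = M.observational N) :
    variance (M'.output N) M'.PU = variance (M.output N) M.PU ∧ M'.phi N = M.phi N := by
  obtain ⟨s, hs, hmap, hout⟩ := exists_reparametrization hN hM hD hM' h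
  have := hM.isProbabilityMeasure
  have := hM'.isProbabilityMeasure
  have hS : Measurable fun (u : Fin p → ℝ) i => s i (u i) :=
    measurable_pi_lambda _ fun i => (hs i).monotone.measurable.comp (measurable_pi_apply i)
  have hint : Integrable (M.output N) (M'.PU.map fun u i => s i (u i)) := by
    rw [hmap]
    exact hL.integrable one_le_two
  constructor
  · rw [variance_congr hout, ← variance_map hint.aemeasurable hS.aemeasurable, hmap]
  · funext I
    have hce := condExp_comp_ae_eq hS (noiseSigma_le I) hint
    -- The pulled-back sigma-algebra is that of `U_I` itself, so the conditional expectations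
    -- correspond under the reparametrization.
    rw [comap_noiseSigma (fun i => (hs i).monotone.measurable) fun i => (hs i).injective] at hce
    unfold phi
    rw [variance_congr ((condExp_congr_ae hout).trans hce), ← variance_map
      (integrable_condExp.aemeasurable) hS.aemeasurable, hmap]

theorem normPhi_eq {N : (Fin p → ℝ) → ℝ} (hN : Measurable N)
    {M M' : CausalModel p} (hM : M.InFamily) (hD : M.DiffeoSufficient)
    (hL : MemLp (M.output N) 2 M.PU) (hM' : M'.InFamily)
    (h : M'.observational N = M.observational N) : M'.normPhi N = M.normPhi N := by
  obtain ⟨hvar, hphi⟩ := variance_output_eq_and_phi_eq hN hM hD hL hM' h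
  funext I
  unfold normPhi
  rw [hvar, hphi]

end CausalModel

/-! ### From equality of `φ` to identifiability -/

theorem SameICC.of_eq {p : ℕ} (G : Digraph (Fin p)) {φ φ' : Finset (Fin p) → ℝ} (h : φ = φ') :
    SameICC G φ φ' := by
  subst h
  exact fun j => ⟨fun _ _ => rfl, rfl, rfl⟩

/-- A quantity that agrees on observationally equivalent models is identifiable. -/
theorem IsIdentifiable.of_forall_eq {p : ℕ} {N : (Fin p → ℝ) → ℝ} {C : Set (CausalModel p)}
    {Q : CausalModel p → ℝ}
    (h : ∀ M ∈ C, ∀ M' ∈ C, M'.observational N = M.observational N → Q M' = Q M) :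
    IsIdentifiable N C Q := by
  classical
  -- Evaluate `Q` at any chosen model in `C` with law `P`; the value 0 on laws not arising from `C`
  -- is arbitrary.
  refine ⟨fun P => if hP : ∃ M ∈ C, M.observational N = P then Q hP.choose else 0,
    fun M hM => ?_⟩
  have hex : ∃ M' ∈ C, M'.observational N = M.observational N := ⟨M, hM, rfl⟩
  dsimp only
  rw [dif_pos hex]
  exact (h M hM _ hex.choose_spec.1 hex.choose_spec.2).symm

theorem ICCIdentifiable.of_forall_eq {p : ℕ} {N : (Fin p → ℝ) → ℝ} (G : Digraph (Fin p))
    {C : Set (CausalModel p)} {φ : CausalModel p → Finset (Fin p) → ℝ}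
    (h : ∀ M ∈ C, ∀ M' ∈ C, M'.observational N = M.observational N → φ M' = φ M) :
    ICCIdentifiable N G C φ := fun j =>
  ⟨fun I _ => .of_forall_eq fun M hM M' hM' e =>
      congrArg (fun ψ => icc ψ j I) (h M hM M' hM' e),
    .of_forall_eq fun M hM M' hM' e => congrArg (fun ψ => iccShapley ψ j) (h M hM M' hM' e),
    .of_forall_eq fun M hM M' hM' e =>
      congrArg (fun ψ => iccTopological G ψ j) (h M hM M' hM' e)⟩

/-- `N` is the network, `G` the causal graph of the features, `M` the data-generating model, and
`M₁`, `M₂` are two causal normalizing flows. -/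
theorem mainTheorem2 {p : ℕ} (N : (Fin p → ℝ) → ℝ) (hN : Measurable N)
    (G : Digraph (Fin p)) (hG : IsDAG G) :
    (∀ M M₁ M₂ : CausalModel p,
      M.InFamily → M.DiffeoSufficient → MemLp (M.output N) 2 M.PU →
      M₁.InFamily → M₂.InFamily →
      M₁.observational N = M.observational N → M₂.observational N = M.observational N →
        (SameICC G (M₁.phi N) (M₂.phi N) ∧ SameICC G (M₁.phi N) (M.phi N)) ∧
        (variance (M.output N) M.PU ≠ 0 →
          SameICC G (M₁.normPhi N) (M₂.normPhi N) ∧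
          SameICC G (M₁.normPhi N) (M.normPhi N))) ∧
    ICCIdentifiable N G
      {M | M.InFamily ∧ M.DiffeoSufficient ∧ MemLp (M.output N) 2 M.PU}
      (fun M => M.phi N) ∧
    ICCIdentifiable N G
      {M | M.InFamily ∧ M.DiffeoSufficient ∧ MemLp (M.output N) 2 M.PU ∧
        variance (M.output N) M.PU ≠ 0}
      (fun M => M.normPhi N) := by
  refine ⟨fun M M₁ M₂ hM hD hL hM₁ hM₂ h₁ h₂ => ⟨?_, fun _ => ?_⟩,
    .of_forall_eq G fun M hM M' hM' e =>
      (CausalModel.variance_output_eq_and_phi_eq hN hM.1 hM.2.1 hM.2.2 hM'.1 e).2,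
    .of_forall_eq G fun M hM M' hM' e =>
      CausalModel.normPhi_eq hN hM.1 hM.2.1 hM.2.2.1 hM'.1 e⟩
  · have e₁ := (CausalModel.variance_output_eq_and_phi_eq hN hM hD hL hM₁ h₁).2
    have e₂ := (CausalModel.variance_output_eq_and_phi_eq hN hM hD hL hM₂ h₂).2
    exact ⟨.of_eq G (e₁.trans e₂.symm), .of_eq G e₁⟩
  · have e₁ := CausalModel.normPhi_eq hN hM hD hL hM₁ h₁
    have e₂ := CausalModel.normPhi_eq hN hM hD hL hM₂ h₂
    exact ⟨.of_eq G (e₁.trans e₂.symm), .of_eq G e₁⟩
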